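/- Let $G$ be a locally compact Hausdorff group with modular function $\Delta_G$ (normalized by $\sigma(Ex)=\Delta_G(x)\sigma(E)$) and a fixed left Haar measure $\sigma$, and let $H$ be a compact subgroup of $G$ with its normalized (probability) Haar measure $dh$. For $f\in\mathcal C_c(G)$ put $T_H(f)(xH)=\int_H f(xh)\,dh$, and let $\mu$ be the normalized $G$-invariant Radon measure on $G/H$, that is, the one satisfying Weil's formula $$\int_{G/H}T_H(f)\,d\mu=\int_G f\,d\sigma\qquad(f\in\mathcal C_c(G)).$$ For $\varphi\in\mathcal C_c(G/H)$ the involution of $\varphi$ is $$\varphi^{\ast}(xH)=\Delta_G(x^{-1})\int_H\overline{\varphi(h^{-1}x^{-1}H)}\,dh ;$$ the involution on $L^1(G/H,\mu)$ is the continuous extension of this map from the dense subspace $\mathcal C_c(G/H)$. Let $M(G/H)$ be the space of regular complex Borel measures on $G/H$. For $\lambda\in M(G/H)$ the involution $\lambda^{\ast}\in M(G/H)$ is the regular complex Borel measure determined by $$\int_{G/H}\psi\,d\lambda^{\ast}=\int_{G/H}\left(\int_H\psi(h^{-1}x^{-1}H)\,dh\right)d\overline{\lambda}(xH)\qquad(\psi\in\mathcal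 C_0(G/H)).$$ For $\varphi\in L^1(G/H,\mu)$ let $\mu_\varphi$ be the complex measure $\mu_\varphi(E)=\int_E\varphi\,d\mu$. Then the continuous extension of the involution to $L^1(G/H,\mu)$ exists, and for every $\varphi\in L^1(G/H,\mu)$: $\mu_\varphi$ is regular with $\int_{G/H}\psi\,d\mu_\varphi=\int_{G/H}\psi\varphi\,d\mu$ for all $\psi\in\mathcal C_0(G/H)$; the measure $(\mu_\varphi)^{\ast}$ exists; and $$(\mu_\varphi)^{\ast}=\mu_{\varphi^{\ast}}.$$ -/

import Mathlib

open MeasureTheory Topology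
open scoped ZeroAtInfty CompactlySupported

noncomputable section

namespace CosetMeasure

/-! ### Complex Radon measures and the Riesz-Markov correspondence -/

section Riesz

variable {X : Type*} [TopologicalSpace X] [MeasurableSpace X]

/-- The integral `∫ ψ dν` of a complex function against a complex measure. -/
def cintegral (ν : ComplexMeasure X) (ψ : X → ℂ) : ℂ :=
  ν.integral ψ (ContinuousLinearMap.mul ℝ ℂ)

/-- `ν` is the regular complex Borel measure representing the functional `Λ` on `C₀(X)`:
its total variation is regular, and `∫ ψ dν = Λ ψ` for all `ψ ∈ C₀(X)`. -/
def Represents (ν : ComplexMeasure X) (Λ : C₀(X, ℂ) → ℂ) : Prop :=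
  ν.variation.Regular ∧ ∀ ψ : C₀(X, ℂ), cintegral ν ψ = Λ ψ

open scoped Classical in
/-- The regular complex Borel measure representing a functional `Λ` on `C₀(X)`
(it exists and is unique for bounded linear `Λ` on a locally compact Hausdorff space;
the value is `0` if there is none). -/
def rieszMeasure (Λ : C₀(X, ℂ) → ℂ) : ComplexMeasure X :=
  if h : ∃ ν : ComplexMeasure X, Represents ν Λ then h.choose else 0

end Riesz

/-- The complex conjugate `ν̄(E) = conj (ν(E))` of a complex measure. -/
def conjMeasure {X : Type*} [MeasurableSpace X] (ν : ComplexMeasure X) : ComplexMeasure X :=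
  ν.mapRange (starRingEnd ℂ).toAddMonoidHom Complex.continuous_conj

/-! ### The modular function -/

section Modular

variable {G : Type*} [Group G] [TopologicalSpace G] [IsTopologicalGroup G]
  [LocallyCompactSpace G]

/-- The modular function `Δ_G`, normalised by `σ(E x) = Δ_G(x) σ(E)` for a left Haar measure `σ`
(see `measure_image_mul_right`). Mathlib's `modularCharacter` is its inverse. -/
def modularFn (x : G) : ℝ := (Measure.modularCharacter x⁻¹ : NNReal)

theorem measure_image_mul_right [MeasurableSpace G] [BorelSpace G] (σ : Measure G)
    [σ.IsHaarMeasure] (x : G) {K : Set G} (hK : IsCompact (closure K)) :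
    σ ((fun y => y * x) '' K) = ENNReal.ofReal (modularFn x) * σ K := by
  have h1 : (fun y : G => y * x) '' K = (fun y => y * x⁻¹) ⁻¹' K := by
    ext y; constructor
    · rintro ⟨z, hz, rfl⟩; simpa using hz
    · intro hy; exact ⟨y * x⁻¹, hy, by simp⟩
  have h2 := Measure.measure_isMulInvariant_eq_smul_of_isCompact_closure
    (Measure.map (fun y => y * x⁻¹) σ) σ hK
  rw [← Measure.modularCharacterFun_eq_haarScalarFactor] at h2
  have h3 : Measure.map (fun y => y * x⁻¹) σ K = σ ((fun y => y * x⁻¹) ⁻¹' K) :=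
    (Homeomorph.mulRight x⁻¹).toMeasurableEquiv.map_apply K
  rw [h1, ← h3, h2, modularFn, ENNReal.ofReal_coe_nnreal]
  rfl

theorem modularFn_mul (x y : G) : modularFn (x * y) = modularFn x * modularFn y := by
  simp [modularFn, mul_comm]

open scoped Pointwise in
/-- The modular function is trivial on compact subgroups. -/
theorem modularFn_of_mem (H : Subgroup G) [CompactSpace H] {k : G} (hk : k ∈ H) :
    modularFn k = 1 := by
  borelize G
  obtain ⟨K, hK, hK1⟩ := exists_compact_mem_nhds (1 : G)
  have hH : IsCompact (H : Set G) := isCompact_iff_compactSpace.2 ‹_›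
  have hKH : IsCompact (K * (H : Set G)) := hK.mul hH
  have himg : (fun y => y * k) '' (K * (H : Set G)) = K * (H : Set G) := by
    ext y; constructor
    · rintro ⟨_, ⟨a, ha, b, hb, rfl⟩, rfl⟩
      exact ⟨a, ha, b * k, H.mul_mem hb hk, by simp [mul_assoc]⟩
    · rintro ⟨a, ha, b, hb, rfl⟩
      exact ⟨a * (b * k⁻¹), ⟨a, ha, _, H.mul_mem hb (H.inv_mem hk), rfl⟩, by simp [mul_assoc]⟩
  have hsub : K ⊆ K * (H : Set G) := fun a ha => ⟨a, ha, 1, H.one_mem, mul_one a⟩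
  have h := measure_image_mul_right (Measure.haar : Measure G) k hKH.closure
  rw [himg] at h
  have hpos : (Measure.haar : Measure G) (K * (H : Set G)) ≠ 0 :=
    (lt_of_lt_of_le (Measure.measure_pos_of_mem_nhds _ hK1) (measure_mono hsub)).ne'
  have hfin : (Measure.haar : Measure G) (K * (H : Set G)) ≠ ⊤ := hKH.measure_lt_top.ne
  have h1 : ENNReal.ofReal (modularFn k) = 1 :=
    (ENNReal.mul_left_inj hpos hfin).1 (by rw [← h, one_mul])
  simpa using h1

end Modular

/-! ### Functions on the coset space -/

section Coset

set_option linter.unusedSectionVars false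

variable {G : Type*} [Group G] [TopologicalSpace G] [IsTopologicalGroup G]
  [LocallyCompactSpace G] [MeasurableSpace G] [BorelSpace G] {H : Subgroup G}

/-- The operator `T_H`: `T_H f (xH) = ∫_H f(xh) dh`, where `dh = η` is a left Haar measure
of `H`. -/
def cosetAverage (η : Measure H) [η.IsMulLeftInvariant] (f : G → ℂ) : G ⧸ H → ℂ :=
  fun y => Quotient.liftOn' y (fun x => ∫ h : H, f (x * h) ∂η) (by
    intro a b hab
    rw [QuotientGroup.leftRel_apply] at hab
    have := integral_mul_left_eq_self (μ := η) (fun h : H => f (a * h)) ⟨a⁻¹ * b, hab⟩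
    simpa [mul_assoc] using this.symm)

/-- The function `xH ↦ ∫_H ψ(h⁻¹x⁻¹H) dh` on `G/H`. -/
def inverseAverage (η : Measure H) [η.IsMulLeftInvariant] (ψ : G ⧸ H → ℂ) : G ⧸ H → ℂ :=
  cosetAverage η (fun x => ψ ((x⁻¹ : G) : G ⧸ H))

theorem inverseAverage_mk (η : Measure H) [η.IsMulLeftInvariant] (ψ : G ⧸ H → ℂ) (x : G) :
    inverseAverage η ψ (x : G ⧸ H)
      = ∫ h : H, ψ (((h : G)⁻¹ * x⁻¹ : G) : G ⧸ H) ∂η := by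
  change ∫ h : H, ψ (((x * (h : G))⁻¹ : G) : G ⧸ H) ∂η = _
  simp [mul_inv_rev]

/-- The modular function as a function on `G/H`, `xH ↦ Δ_G(x⁻¹)`, for compact `H`. -/
def cosetModularInv [CompactSpace H] : G ⧸ H → ℝ :=
  fun y => Quotient.liftOn' y (fun x => modularFn x⁻¹) (by
    intro a b hab
    rw [QuotientGroup.leftRel_apply] at hab
    have h1 : modularFn (b⁻¹ * a) = 1 := modularFn_of_mem H (by simpa using H.inv_mem hab)
    have h2 : a⁻¹ = a⁻¹ * b * b⁻¹ := by simp
    change modularFn a⁻¹ = modularFn b⁻¹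
    rw [h2, modularFn_mul, modularFn_of_mem H hab, one_mul])

/-- The involution of functions: `φ^*(xH) = Δ_G(x⁻¹) ∫_H conj φ(h⁻¹x⁻¹H) dh`. -/
def fnInvolution [CompactSpace H] (η : Measure H) [η.IsMulLeftInvariant]
    (φ : G ⧸ H → ℂ) : G ⧸ H → ℂ :=
  fun y => (cosetModularInv y : ℂ) * inverseAverage η (fun z => starRingEnd ℂ (φ z)) y

theorem fnInvolution_mk [CompactSpace H] (η : Measure H) [η.IsMulLeftInvariant]
    (φ : G ⧸ H → ℂ) (x : G) :
    fnInvolution η φ (x : G ⧸ H)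
      = (modularFn x⁻¹ : ℂ) * ∫ h : H, starRingEnd ℂ (φ (((h : G)⁻¹ * x⁻¹ : G) : G ⧸ H)) ∂η := by
  rw [fnInvolution, inverseAverage_mk]
  rfl

variable [MeasurableSpace (G ⧸ H)]

/-- `T : L¹(G/H, μ) → L¹(G/H, μ)` is continuous and extends the involution of functions
on `C_c(G/H)`. -/
def IsInvolutionExtension [CompactSpace H] (η : Measure H) [η.IsMulLeftInvariant]
    (μ : Measure (G ⧸ H)) (T : Lp ℂ 1 μ → Lp ℂ 1 μ) : Prop :=
  Continuous T ∧ ∀ (ψ : C_c(G ⧸ H, ℂ)) (φ : Lp ℂ 1 μ),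
    φ =ᵐ[μ] ψ → T φ =ᵐ[μ] fnInvolution η ψ

open scoped Classical in
/-- The involution `φ ↦ φ^*` on `L¹(G/H, μ)`: the continuous extension of the involution on the
dense subspace `C_c(G/H)` (and the zero map if there is none). -/
def l1Involution [CompactSpace H] (η : Measure H) [η.IsMulLeftInvariant]
    (μ : Measure (G ⧸ H)) : Lp ℂ 1 μ → Lp ℂ 1 μ :=
  if h : ∃ T, IsInvolutionExtension η μ T then h.choose else fun _ => 0

/-- The functional `ψ ↦ ∫_{G/H} (∫_H ψ(h⁻¹x⁻¹H) dh) dλ̄(xH)` on `C₀(G/H)` that defines the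
involution of the complex measure `λ`. -/
def involutionFunctional (η : Measure H) [η.IsMulLeftInvariant] (ν : ComplexMeasure (G ⧸ H)) :
    C₀(G ⧸ H, ℂ) → ℂ :=
  fun ψ => cintegral (conjMeasure ν) (inverseAverage η ψ)

/-- The involution `λ ↦ λ^*` on the space `M(G/H)` of regular complex Borel measures. -/
def measureInvolution (η : Measure H) [η.IsMulLeftInvariant] (ν : ComplexMeasure (G ⧸ H)) :
    ComplexMeasure (G ⧸ H) :=
  rieszMeasure (involutionFunctional η ν)

/-- The complex measure `μ_φ(E) = ∫_E φ dμ`, for `φ ∈ L¹(G/H, μ)`. -/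
def densityMeasure (μ : Measure (G ⧸ H)) (φ : Lp ℂ 1 μ) : ComplexMeasure (G ⧸ H) :=
  μ.withDensityᵥ φ

/-- `μ` is the normalized `G`-invariant Radon measure on `G/H`: it is regular, invariant under
the left action of `G`, and satisfies Weil's formula `∫_{G/H} T_H f dμ = ∫_G f dσ` for
`f ∈ C_c(G)`. -/
structure IsNormalizedInvariant [BorelSpace (G ⧸ H)] (σ : Measure G) (η : Measure H)
    [η.IsMulLeftInvariant] (μ : Measure (G ⧸ H)) : Prop where
  regular : μ.Regular
  invariant : ∀ (x : G) (E : Set (G ⧸ H)), MeasurableSet E → μ ((x • ·) '' E) = μ E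
  weil : ∀ f : C_c(G, ℂ), ∫ y, cosetAverage η f y ∂μ = ∫ x, f x ∂σ

end Coset

end CosetMeasure

end

/-! Both sides of the identity are regular complex measures, so it is enough that they induce the
same functional on `C₀(G/H)`. Everything rests on one adjointness relation: `∫ ψ φ^* dμ = ∫ ψ^∨ conj
φ dμ`, where `ψ^∨(xH) = ∫_H ψ(h⁻¹x⁻¹H) dh`. The left side is integration against `μ_{φ^*}`; the
right side is the functional defining `(μ_φ)^*`, because the conjugate of `μ_φ` has density `conj
φ`.

For `φ ∈ C_c(G/H)`, since `Δ` is trivial on the compact group `H`, both integrands are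
`T_H`-averages of functions in `C_c(G)`. Weil's formula moves both integrals to `G`, where they
differ by the substitution `x ↦ x⁻¹`, which costs the factor `Δ(x⁻¹)`
(`integral_inv_mul_modularFn_inv`).

Taking `ψ = 1` and `|φ|` for `φ` shows that the involution contracts the `L¹` norm, so it extends
from the dense subspace `C_c(G/H)`. For bounded continuous `ψ` both sides of the adjointness
relation are continuous in `φ ∈ L¹`, so the relation extends as well. Hence `μ_{φ^*}` itself
witnesses the existence of `(μ_φ)^*`, and `Represents.unique` identifies the two. -/

open scoped ENNReal

set_option linter.unusedSectionVars false

namespace MeasureTheory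

/-! ### Complex measures with an integrable density -/

section ComplexMeasure

variable {X : Type*} [MeasurableSpace X]

/-- The total variation of a complex measure is finite. -/
theorem ComplexMeasure.isFiniteMeasure_variation (ν : ComplexMeasure X) :
    IsFiniteMeasure ν.variation := by
  refine isFiniteMeasure_of_le
    ((ComplexMeasure.re ν).totalVariation + (ComplexMeasure.im ν).totalVariation) ?_
  refine VectorMeasure.variation_le_of_forall_enorm_le fun E hE => ?_
  have h1 := (ComplexMeasure.re ν).enorm_le_totalVariation E
  have h2 := (ComplexMeasure.im ν).enorm_le_totalVariation E
  have h3 : ‖ν E‖ₑ ≤ ‖(ν E).re‖ₑ + ‖(ν E).im‖ₑ := by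
    rw [← ofReal_norm, ← ofReal_norm, ← ofReal_norm,
      ← ENNReal.ofReal_add (norm_nonneg _) (norm_nonneg _)]
    exact ENNReal.ofReal_le_ofReal (Complex.norm_le_abs_re_add_abs_im _)
  exact h3.trans (add_le_add h1 h2)

variable {μ : Measure X}

/-- The integral against a complex measure with an integrable density. -/
theorem integral_withDensityᵥ_complex {f : X → ℂ} (hf : Integrable f μ) {ψ : X → ℂ}
    (hψ : StronglyMeasurable ψ) {C : ℝ} (hC : ∀ x, ‖ψ x‖ ≤ C) :
    (μ.withDensityᵥ f).integral ψ (ContinuousLinearMap.mul ℝ ℂ) = ∫ x, ψ x * f x ∂μ := by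
  have := ComplexMeasure.isFiniteMeasure_variation (μ.withDensityᵥ f)
  have hsimple : ∀ s : SimpleFunc X ℂ,
      (μ.withDensityᵥ f).integral s (ContinuousLinearMap.mul ℝ ℂ) = ∫ x, s x * f x ∂μ := by
    intro s
    induction s using SimpleFunc.induction with
    | const c hs =>
      rename_i E
      have hE : ⇑(SimpleFunc.piecewise E hs (SimpleFunc.const X c) (SimpleFunc.const X 0))
          = E.indicator fun _ => c := by
        ext x
        by_cases hx : x ∈ E <;> simp [hx]
      rw [hE, VectorMeasure.integral_indicator hs, VectorMeasure.setIntegral_const,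
        withDensityᵥ_apply hf hs, ContinuousLinearMap.mul_apply', ← integral_const_mul, ← integral_indicator hs]
      congr 1 with x
      by_cases hx : x ∈ E <;> simp [hx]
    | add _ hs ht =>
      rename_i s t _
      rw [SimpleFunc.coe_add, VectorMeasure.integral_add (SimpleFunc.integrable_of_isFiniteMeasure s)
        (SimpleFunc.integrable_of_isFiniteMeasure t), hs, ht, ← integral_add]
      · simp [add_mul]
      · obtain ⟨D, hD⟩ := s.exists_forall_norm_le
        exact hf.bdd_mul s.aestronglyMeasurable (.of_forall hD)
      · obtain ⟨D, hD⟩ := t.exists_forall_norm_le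
        exact hf.bdd_mul t.aestronglyMeasurable (.of_forall hD)
  -- A point of `X` is needed to deduce `0 ≤ C` from the bound on `ψ`.
  rcases isEmpty_or_nonempty X with hX | ⟨⟨x₀⟩⟩
  · simp [Measure.eq_zero_of_isEmpty μ, VectorMeasure.integral_of_isEmpty]
  have hC0 : 0 ≤ C := (norm_nonneg _).trans (hC x₀)
  have hbound : ∀ n x, ‖hψ.approxBounded C n x‖ ≤ C := fun n x => hψ.norm_approxBounded_le hC0 n x
  have hlim : ∀ x, Filter.Tendsto (fun n => hψ.approxBounded C n x) Filter.atTop (𝓝 (ψ x)) :=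
    fun x => hψ.tendsto_approxBounded_of_norm_le (hC x)
  refine tendsto_nhds_unique (VectorMeasure.tendsto_integral_of_dominated_convergence
    (B := ContinuousLinearMap.mul ℝ ℂ) (fun _ => C)
    (fun n => SimpleFunc.aestronglyMeasurable _) (integrable_const C)
    (fun n => .of_forall (hbound n)) (.of_forall hlim)) ?_
  simp_rw [hsimple]
  refine tendsto_integral_of_dominated_convergence (fun x => C * ‖f x‖)
    (fun n => (SimpleFunc.aestronglyMeasurable _).mul hf.1) (hf.norm.const_mul C)
    (fun n => .of_forall fun x => ?_) (.of_forall fun x => (hlim x).mul_const _)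
  rw [norm_mul]
  exact mul_le_mul_of_nonneg_right (hbound n x) (norm_nonneg _)

theorem conjMeasure_withDensityᵥ {f : X → ℂ} (hf : Integrable f μ) :
    CosetMeasure.conjMeasure (μ.withDensityᵥ f)
      = μ.withDensityᵥ (fun x => starRingEnd ℂ (f x)) := by
  ext E hE
  have hf' : Integrable (fun x => starRingEnd ℂ (f x)) μ :=
    (LinearIsometryEquiv.integrable_comp_iff Complex.conjLIE).2 hf
  rw [withDensityᵥ_apply hf' hE, integral_conj, CosetMeasure.conjMeasure,
    VectorMeasure.mapRange_apply, withDensityᵥ_apply hf hE]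
  rfl

end ComplexMeasure

/-! ### Regularity, density of `C_c` in `Lᵖ`, and uniqueness of representing measures -/

section Regular

variable {X : Type*} [TopologicalSpace X] [MeasurableSpace X] [BorelSpace X] [R1Space X]

/-- A finite measure with a density with respect to a regular measure is regular. -/
theorem Measure.Regular.withDensity_of_lintegral_ne_top {μ : Measure X} [μ.Regular] {f : X → ℝ≥0∞}
    (hf : Measurable f) (hfi : ∫⁻ x, f x ∂μ ≠ ∞) : (μ.withDensity f).Regular := by
  have hfin : IsFiniteMeasure (μ.withDensity f) := ⟨by simpa using hfi.lt_top⟩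
  suffices (μ.withDensity f).InnerRegularCompactLTTop by infer_instance
  refine ⟨fun E hE r hr => ?_⟩
  have hE' := hE.1
  -- The sets where `f ≥ 1/(n+1)` have finite `μ`-measure by Markov's inequality, so inner
  -- regularity of `μ` applies to `A n`. What they miss of `E` lies in `{f = 0}`, which is null for
  -- the new measure.
  let A : ℕ → Set X := fun n => E ∩ {x | (n + 1 : ℝ≥0∞)⁻¹ ≤ f x}
  have hA : ∀ n, MeasurableSet (A n) := fun n => hE'.inter (measurableSet_le measurable_const hf)
  have hmono : Monotone A := by
    intro m n hmn x hx
    have h : (n + 1 : ℝ≥0∞)⁻¹ ≤ (m + 1 : ℝ≥0∞)⁻¹ := ENNReal.inv_le_inv.2 (by gcongr)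
    exact ⟨hx.1, h.trans hx.2⟩
  have hU : μ.withDensity f E = μ.withDensity f (⋃ n, A n) := by
    rw [← Set.inter_iUnion]
    refine le_antisymm ?_ (measure_mono Set.inter_subset_left)
    rw [← measure_inter_add_sdiff E (MeasurableSet.iUnion fun n : ℕ => measurableSet_le
      (measurable_const (a := (n + 1 : ℝ≥0∞)⁻¹)) hf)]
    suffices μ.withDensity f (E \ ⋃ n : ℕ, {x | (n + 1 : ℝ≥0∞)⁻¹ ≤ f x}) = 0 by simp [this]
    rw [withDensity_apply_eq_zero hf]
    convert measure_empty (μ := μ)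
    ext x
    simp only [Set.mem_inter_iff, Set.mem_ofPred_eq, Set.mem_sdiff, Set.mem_iUnion, not_exists,
      not_le, Set.mem_empty_iff_false, iff_false, not_and, ne_eq]
    intro hx _ h
    obtain ⟨n, hn⟩ := ENNReal.exists_inv_nat_lt hx
    refine lt_irrefl _ ((h n).trans_le' (le_trans ?_ hn.le))
    exact ENNReal.inv_le_inv.2 le_self_add
  rw [hU, hmono.measure_iUnion] at hr
  obtain ⟨n, hn⟩ := lt_iSup_iff.1 hr
  have hAfin : μ (A n) ≠ ∞ := by
    refine ne_top_of_le_ne_top ?_ (measure_mono Set.inter_subset_right)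
    exact (meas_ge_le_lintegral_div hf.aemeasurable (by simp) (by simp)).trans_lt
      (ENNReal.div_lt_top hfi (by simp)) |>.ne
  -- Absolute continuity of the integral turns a small `μ (A n \ K)` into a loss below the available
  -- margin, the mass of `A n` minus `r`.
  obtain ⟨δ, hδ, h⟩ := exists_pos_setLIntegral_lt_of_measure_lt hfi (tsub_pos_of_lt hn).ne'
  obtain ⟨K, hKA, hK, hKδ⟩ := (hA n).exists_isCompact_isClosed_sdiff_lt hAfin hδ.ne'
  refine ⟨K, hKA.trans Set.inter_subset_left, hK, ?_⟩
  have h1 := h _ hKδ.2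
  rw [← withDensity_apply _ ((hA n).diff hKδ.1.measurableSet)] at h1
  have h2 := measure_le_inter_add_sdiff (μ.withDensity f) (A n) K
  rw [Set.inter_eq_self_of_subset_right hKA] at h2
  by_contra! h3
  have h4 : μ.withDensity f (A n) < r + (μ.withDensity f (A n) - r) :=
    h2.trans_lt (ENNReal.add_lt_add_of_le_of_lt (measure_ne_top _ _) h3 h1)
  rw [add_tsub_cancel_of_le hn.le] at h4
  exact lt_irrefl _ h4

theorem regular_variation_withDensityᵥ {E : Type*} [NormedAddCommGroup E] [NormedSpace ℝ E]
    [CompleteSpace E] {μ : Measure X} [μ.Regular] {f : X → E} (hfm : StronglyMeasurable f)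
    (hf : Integrable f μ) : (μ.withDensityᵥ f).variation.Regular := by
  rw [Measure.variation_withDensityᵥ hf]
  exact Measure.Regular.withDensity_of_lintegral_ne_top hfm.enorm hf.2.ne

variable [LocallyCompactSpace X]

/-- On a locally compact space, compactly supported continuous functions are dense in `Lᵖ` of a
regular measure. -/
theorem MemLp.exists_continuous_hasCompactSupport_eLpNorm_sub_le {E : Type*}
    [NormedAddCommGroup E] [NormedSpace ℝ E] {μ : Measure X} [μ.Regular] {p : ℝ≥0∞} (hp : p ≠ ∞)
    {f : X → E} (hf : MemLp f p μ) {ε : ℝ≥0∞} (hε : ε ≠ 0) :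
    ∃ g : X → E, eLpNorm (f - g) p μ ≤ ε ∧ Continuous g ∧ HasCompactSupport g := by
  suffices H : ∃ g : X → E, eLpNorm (f - g) p μ ≤ ε ∧
      (AEStronglyMeasurable g μ ∧ Continuous g ∧ HasCompactSupport g) by
    obtain ⟨g, h1, -, h2⟩ := H
    exact ⟨g, h1, h2⟩
  refine hf.induction_dense hp _ (fun c t ht htμ ε hε => ?_)
    (fun f g hf hg => ⟨hf.1.add hg.1, hf.2.1.add hg.2.1, hf.2.2.add hg.2.2⟩)
    (fun f hf => hf.1) hε
  obtain ⟨η, hη0, hη⟩ := exists_eLpNorm_indicator_le (μ := μ) hp c hε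
  have hη2 : (η : ℝ≥0∞) / 2 ≠ 0 := by simpa using hη0.ne'
  obtain ⟨U, htU, hU, -, hUt⟩ := ht.exists_isOpen_sdiff_lt htμ.ne hη2
  obtain ⟨K, hKt, hK, hKc, hKt'⟩ := ht.exists_isCompact_isClosed_sdiff_lt htμ.ne hη2
  obtain ⟨g, hg1, hgc, hgU, hg01⟩ :=
    exists_continuousMap_one_of_isCompact_subset_isOpen hK hU (hKt.trans htU)
  have hUK : μ (U \ K) ≤ η := by
    calc μ (U \ K) ≤ μ ((U \ t) ∪ (t \ K)) := measure_mono fun x hx => by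
          by_cases hxt : x ∈ t
          · exact Or.inr ⟨hxt, hx.2⟩
          · exact Or.inl ⟨hx.1, hxt⟩
      _ ≤ η / 2 + η / 2 := (measure_union_le _ _).trans (add_le_add hUt.le hKt'.le)
      _ = η := ENNReal.add_halves _
  -- The Urysohn function `g` agrees with the indicator of `t` off `U \ K` and differs from it by at
  -- most `1` there, so the error is dominated by `c` on a set of measure at most `η`.
  refine ⟨fun x => g x • c, (eLpNorm_mono fun x => ?_).trans (hη _ hUK), ?_, by fun_prop, ?_⟩
  · by_cases hxK : x ∈ K
    · simp [hg1 hxK, hKt hxK]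
    by_cases hxU : x ∈ U
    · rw [Set.indicator_of_mem (show x ∈ U \ K from ⟨hxU, hxK⟩), Pi.sub_apply]
      by_cases hxt : x ∈ t
      · rw [Set.indicator_of_mem hxt, show g x • c - c = (g x - 1) • c by rw [sub_smul, one_smul],
          norm_smul, Real.norm_eq_abs]
        refine mul_le_of_le_one_left (norm_nonneg _) (abs_le.2 ⟨?_, ?_⟩) <;>
          linarith [(hg01 x).1, (hg01 x).2]
      · rw [Set.indicator_of_notMem hxt, sub_zero, norm_smul, Real.norm_eq_abs]
        refine mul_le_of_le_one_left (norm_nonneg _) (abs_le.2 ⟨?_, ?_⟩) <;>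
          linarith [(hg01 x).1, (hg01 x).2]
    · have : g x = 0 := image_eq_zero_of_notMem_tsupport fun h => hxU (hgU h)
      have hxt : x ∉ t := fun h => hxU (htU h)
      simp [this, hxt]
  · exact g.continuous.stronglyMeasurable.smul_const c |>.aestronglyMeasurable
  · exact HasCompactSupport.smul_right hgc

/-- Regular complex measures are determined by the integrals of compactly supported continuous
functions. -/
theorem ComplexMeasure.ext_of_integral_eq {ν₁ ν₂ : ComplexMeasure X} (h₁ : ν₁.variation.Regular)
    (h₂ : ν₂.variation.Regular)
    (h : ∀ ψ : X → ℂ, Continuous ψ → HasCompactSupport ψ →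
      ν₁.integral ψ (ContinuousLinearMap.mul ℝ ℂ) = ν₂.integral ψ (ContinuousLinearMap.mul ℝ ℂ)) :
    ν₁ = ν₂ := by
  have := ν₁.isFiniteMeasure_variation
  have := ν₂.isFiniteMeasure_variation
  -- Approximating the indicator of `E` in `L¹` of the sum controls the error for both measures with
  -- a single test function.
  have hreg : (ν₁.variation + ν₂.variation).Regular := by infer_instance
  ext E hE
  have hint : Integrable (E.indicator fun _ => (1 : ℂ)) (ν₁.variation + ν₂.variation) :=
    (integrable_const 1).indicator hE
  have key : ∀ {ν : ComplexMeasure X} {g : X → ℂ} {ε : ℝ≥0∞}, IsFiniteMeasure ν.variation →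
      ν.variation ≤ ν₁.variation + ν₂.variation →
      Integrable g (ν₁.variation + ν₂.variation) →
      eLpNorm (E.indicator (fun _ => (1 : ℂ)) - g) 1 (ν₁.variation + ν₂.variation) ≤ ε →
      edist (ν E) (ν.integral g (ContinuousLinearMap.mul ℝ ℂ)) ≤ ε := by
    intro ν g ε _ hle hg hε
    have h1 : ν E = ν.integral (E.indicator fun _ => (1 : ℂ)) (ContinuousLinearMap.mul ℝ ℂ) := by
      rw [VectorMeasure.integral_indicator hE, VectorMeasure.setIntegral_const]
      simp
    rw [h1]
    refine (VectorMeasure.edist_integral_le_lintegral_edist (hint.mono_measure hle)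
      (hg.mono_measure hle)).trans ?_
    have h2 : ‖ContinuousLinearMap.mul ℝ ℂ‖ₑ = 1 := by
      rw [← ofReal_norm, ContinuousLinearMap.opNorm_mul, ENNReal.ofReal_one]
    rw [h2, one_mul]
    refine (lintegral_mono' hle le_rfl).trans ?_
    simpa [edist_eq_enorm_sub, eLpNorm_one_eq_lintegral_enorm] using hε
  refine eq_of_forall_dist_le fun ε hε => ?_
  obtain ⟨g, hgε, hgc, hgs⟩ :=
    (memLp_one_iff_integrable.2 hint).exists_continuous_hasCompactSupport_eLpNorm_sub_le
      ENNReal.one_ne_top (ε := ENNReal.ofReal (ε / 2)) (by simpa using hε)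
  have hgi : Integrable g (ν₁.variation + ν₂.variation) := hgc.integrable_of_hasCompactSupport hgs
  have k1 := key (ν := ν₁) inferInstance (Measure.le_add_right le_rfl) hgi hgε
  have k2 := key (ν := ν₂) inferInstance (Measure.le_add_left le_rfl) hgi hgε
  rw [← h g hgc hgs] at k2
  rw [edist_dist, ENNReal.ofReal_le_ofReal_iff (by positivity)] at k1 k2
  linarith [dist_triangle_right (ν₁ E) (ν₂ E) (ν₁.integral g (ContinuousLinearMap.mul ℝ ℂ))]

end Regular

end MeasureTheory

namespace CosetMeasure

/-! ### The modular function and inversion of the Haar integral -/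

section Modular

variable {G : Type*} [Group G] [TopologicalSpace G] [IsTopologicalGroup G]
  [LocallyCompactSpace G]

theorem modularFn_pos (x : G) : 0 < modularFn x :=
  NNReal.coe_pos.2 (Measure.modularCharacterFun_pos _)

theorem modularFn_inv (x : G) : modularFn x⁻¹ = (modularFn x)⁻¹ := by
  simp [modularFn]

variable [MeasurableSpace G] [BorelSpace G] (σ : Measure G) [σ.IsHaarMeasure]

/-- A right translate of `σ` is still left invariant, hence a multiple of `σ`; the scalar is
`modularCharacter x`, which is `Δ(x⁻¹)` in the present normalization. -/
theorem integral_mul_right_eq_modularFn_inv {g : G → ℝ} (hg : Continuous g)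
    (hgs : HasCompactSupport g) (x : G) :
    ∫ y, g (y * x) ∂σ = modularFn x⁻¹ * ∫ y, g y ∂σ := by
  have h := Measure.integral_isMulLeftInvariant_eq_smul_of_hasCompactSupport
    (Measure.map (· * x) σ) σ hg hgs
  rw [← Measure.modularCharacterFun_eq_haarScalarFactor, integral_smul_nnreal_measure,
    integral_map (by fun_prop) hg.aestronglyMeasurable] at h
  rw [h, modularFn, inv_inv]
  rfl

/-- For a fixed bump function `g`, `Δ(x) ∫ g dσ = ∫ g(y x⁻¹) dσ(y)`, and rewriting the right side
over `σ.inv` makes it a convolution, continuous in `x`. -/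
theorem continuous_modularFn : Continuous (modularFn : G → ℝ) := by
  borelize G
  obtain ⟨⟨g, hg⟩, hgs, hg0, hg1⟩ :
    ∃ g : C(G, ℝ), HasCompactSupport g ∧ 0 ≤ g ∧ g 1 ≠ 0 := exists_continuous_nonneg_pos 1
  let σ : Measure G := Measure.haar
  have hpos : 0 < ∫ x, g x ∂σ :=
    hg.integral_pos_of_hasCompactSupport_nonneg_nonzero hgs hg0 hg1
  have h1 : Continuous fun x : G => ∫ y, g (y⁻¹ * x) ∂σ.inv :=
    continuous_integral_apply_inv_mul hg hgs
  have h2 : ∀ x : G, modularFn x = (∫ y, g (y⁻¹ * x⁻¹) ∂σ.inv) / ∫ y, g y ∂σ := by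
    intro x
    rw [Measure.inv, integral_map (by fun_prop)
      (Continuous.aestronglyMeasurable (by fun_prop)), eq_div_iff hpos.ne']
    simp_rw [inv_inv]
    rw [integral_mul_right_eq_modularFn_inv σ hg hgs, inv_inv]
  rw [funext h2]
  exact (h1.comp continuous_inv).div_const _

/-- The behaviour of a left Haar integral under inversion. -/
theorem integral_inv_mul_modularFn_inv_real {f : G → ℝ} (hf : Continuous f)
    (hfs : HasCompactSupport f) :
    ∫ x, modularFn x⁻¹ * f x⁻¹ ∂σ = ∫ x, f x ∂σ := by
  obtain ⟨⟨g, hg⟩, hgs, hg0, hg1⟩ :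
    ∃ g : C(G, ℝ), HasCompactSupport g ∧ 0 ≤ g ∧ g 1 ≠ 0 := exists_continuous_nonneg_pos 1
  have hpos : 0 < ∫ x, g x ∂σ :=
    hg.integral_pos_of_hasCompactSupport_nonneg_nonzero hgs hg0 hg1
  -- This compares `σ` with the right invariant `σ.inv` through an auxiliary `g`. The inner integral
  -- is `Δ(x⁻¹) ∫ g dσ`, so `∫ g dσ` cancels and only the modular factor remains.
  have h := Measure.integral_isMulLeftInvariant_isMulRightInvariant_combo (μ := σ) (ν := σ.inv)
    hf hfs hg hgs hg0 hg1
  have h2 : ∀ x : G, ∫ y, g (y⁻¹ * x) ∂σ.inv = modularFn x⁻¹ * ∫ y, g y ∂σ := by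
    intro x
    rw [Measure.inv, integral_map (by fun_prop)
      (Continuous.aestronglyMeasurable (by fun_prop))]
    simp_rw [inv_inv]
    exact integral_mul_right_eq_modularFn_inv σ hg hgs x
  have hc := continuous_modularFn (G := G)
  simp_rw [h2, mul_inv, ← mul_assoc] at h
  rw [integral_mul_const, mul_assoc, inv_mul_cancel₀ hpos.ne', mul_one] at h
  simp_rw [modularFn_inv, inv_inv] at h
  rw [h, Measure.inv, integral_map (by fun_prop)
    (Continuous.aestronglyMeasurable (by fun_prop))]
  simp_rw [mul_comm]

theorem integral_inv_mul_modularFn_inv {f : G → ℂ} (hf : Continuous f)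
    (hfs : HasCompactSupport f) :
    ∫ x, (modularFn x⁻¹ : ℂ) * f x⁻¹ ∂σ = ∫ x, f x ∂σ := by
  have hc : Continuous fun x : G => (modularFn x⁻¹ : ℂ) * f x⁻¹ := by
    have := continuous_modularFn (G := G)
    fun_prop
  have hs : HasCompactSupport fun x : G => (modularFn x⁻¹ : ℂ) * f x⁻¹ :=
    HasCompactSupport.mul_left (hfs.comp_homeomorph (Homeomorph.inv G))
  have hi := hc.integrable_of_hasCompactSupport (μ := σ) hs
  have hi' := hf.integrable_of_hasCompactSupport (μ := σ) hfs
  have hre := integral_inv_mul_modularFn_inv_real σ (Complex.continuous_re.comp hf)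
    (hfs.comp_left Complex.zero_re)
  have him := integral_inv_mul_modularFn_inv_real σ (Complex.continuous_im.comp hf)
    (hfs.comp_left Complex.zero_im)
  have h1 := integral_re hi
  have h2 := integral_im hi
  have h3 := integral_re hi'
  have h4 := integral_im hi'
  simp only [RCLike.re_to_complex, RCLike.im_to_complex, Complex.re_ofReal_mul,
    Complex.im_ofReal_mul, Function.comp_def] at h1 h2 h3 h4 hre him
  exact Complex.ext (by rw [← h1, ← h3, hre]) (by rw [← h2, ← h4, him])

end Modular

/-! ### Topology of `G/H` for compact `H` -/

section Quotient

variable {G : Type*} [Group G] [TopologicalSpace G] [IsTopologicalGroup G]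
  (H : Subgroup G) [CompactSpace H]

theorem isCompact_coe_of_compactSpace : IsCompact (H : Set G) := isCompact_iff_compactSpace.2 ‹_›

/-- The quotient map is closed and its fibres are the compact cosets `xH`; properness lets compact
supports be pulled back to `G`. -/
theorem isProperMap_quotientMk : IsProperMap ((↑) : G → G ⧸ H) := by
  refine isProperMap_iff_isClosedMap_and_compact_fibers.2
    ⟨QuotientGroup.continuous_mk, QuotientGroup.isClosedMap_coe (isCompact_coe_of_compactSpace H),
      fun y => ?_⟩
  obtain ⟨x, rfl⟩ := QuotientGroup.mk_surjective y
  have : ((↑) : G → G ⧸ H) ⁻¹' {(x : G ⧸ H)} = (fun z => x * z) '' (H : Set G) := by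
    ext z
    simp only [Set.mem_preimage, Set.mem_singleton_iff, Set.mem_image, SetLike.mem_coe]
    rw [eq_comm, QuotientGroup.eq]
    exact ⟨fun h => ⟨_, h, by simp⟩, fun ⟨w, hw, h⟩ => by simpa [← h] using hw⟩
  rw [this]
  exact (isCompact_coe_of_compactSpace H).image (continuous_const_mul x)

theorem t2Space_quotient [T2Space G] : T2Space (G ⧸ H) := by
  rw [t2Space_iff_of_isOpenQuotientMap QuotientGroup.isOpenQuotientMap_mk]
  simp_rw [QuotientGroup.eq]
  exact (isCompact_coe_of_compactSpace H).isClosed.preimage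
    (continuous_fst.inv.mul continuous_snd)

variable {H}

theorem hasCompactSupport_comp_quotientMk {E : Type*} [Zero E] {φ : G ⧸ H → E}
    (hφ : HasCompactSupport φ) : HasCompactSupport fun x : G => φ (x : G ⧸ H) := by
  refine ((isProperMap_quotientMk H).isCompact_preimage hφ).of_isClosed_subset
    (isClosed_tsupport _) ?_
  refine closure_minimal (fun x hx => subset_tsupport _ hx)
    ((isClosed_tsupport φ).preimage QuotientGroup.continuous_mk)

end Quotient

/-! ### Averages over `H` and the involution on `C_c(G/H)` -/

section CosetAverage

variable {G : Type*} [Group G] [TopologicalSpace G] [IsTopologicalGroup G]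
  [LocallyCompactSpace G] [MeasurableSpace G] [BorelSpace G] {H : Subgroup G} [CompactSpace H]
  (η : Measure H) [η.IsMulLeftInvariant]

theorem cosetAverage_mk (f : G → ℂ) (x : G) :
    cosetAverage η f (x : G ⧸ H) = ∫ h : H, f (x * h) ∂η := rfl

theorem continuous_cosetAverage [IsFiniteMeasure η] {f : G → ℂ} (hf : Continuous f) :
    Continuous (cosetAverage η f) := by
  refine (QuotientGroup.isQuotientMap_mk H).continuous_iff.2 ?_
  change Continuous fun x : G => ∫ h : H, f (x * h) ∂η
  rw [← continuousOn_univ]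
  refine continuousOn_integral_of_compact_support (k := Set.univ) isCompact_univ ?_
    (fun p x _ hx => (hx (Set.mem_univ x)).elim)
  exact Continuous.continuousOn (by fun_prop)

theorem continuous_inverseAverage [IsFiniteMeasure η] {ψ : G ⧸ H → ℂ} (hψ : Continuous ψ) :
    Continuous (inverseAverage η ψ) :=
  continuous_cosetAverage η (hψ.comp (QuotientGroup.continuous_mk.comp continuous_inv))

theorem norm_inverseAverage_le [IsProbabilityMeasure η] {ψ : G ⧸ H → ℂ} {C : ℝ}
    (hC : ∀ y, ‖ψ y‖ ≤ C) (y : G ⧸ H) : ‖inverseAverage η ψ y‖ ≤ C := by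
  obtain ⟨x, rfl⟩ := QuotientGroup.mk_surjective y
  rw [inverseAverage_mk]
  simpa using norm_integral_le_of_norm_le_const (μ := η) (.of_forall fun h : H => hC _)

/-- The function `x ↦ Δ(x⁻¹) conj φ(x⁻¹H)` on the group lifting `φ^*`. -/
noncomputable def liftedInvolution (φ : G ⧸ H → ℂ) (x : G) : ℂ :=
  (modularFn x⁻¹ : ℂ) * starRingEnd ℂ (φ ((x⁻¹ : G) : G ⧸ H))

theorem continuous_liftedInvolution {φ : G ⧸ H → ℂ} (hφ : Continuous φ) :
    Continuous (liftedInvolution φ) := by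
  have h1 := continuous_modularFn (G := G)
  have h2 : Continuous ((↑) : G → G ⧸ H) := QuotientGroup.continuous_mk
  have h3 := Complex.continuous_conj
  unfold liftedInvolution
  fun_prop

theorem hasCompactSupport_liftedInvolution {φ : G ⧸ H → ℂ} (hφ : HasCompactSupport φ) :
    HasCompactSupport (liftedInvolution φ) :=
  HasCompactSupport.mul_left (((hasCompactSupport_comp_quotientMk hφ).comp_homeomorph
    (Homeomorph.inv G)).comp_left (map_zero (starRingEnd ℂ)))

/-- Since `Δ` is trivial on `H`, the factor `Δ(x⁻¹)` passes under the integral over `H`; this puts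
`φ^*` in the form required by Weil's formula. -/
theorem fnInvolution_eq_cosetAverage (φ : G ⧸ H → ℂ) :
    fnInvolution η φ = cosetAverage η (liftedInvolution φ) := by
  ext y
  obtain ⟨x, rfl⟩ := QuotientGroup.mk_surjective y
  rw [fnInvolution_mk, cosetAverage_mk, ← integral_const_mul]
  congr 1 with h
  rw [liftedInvolution, mul_inv_rev, modularFn_mul, modularFn_of_mem H (H.inv_mem h.2), one_mul]

theorem continuous_fnInvolution [IsFiniteMeasure η] {φ : G ⧸ H → ℂ} (hφ : Continuous φ) :
    Continuous (fnInvolution η φ) := by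
  rw [fnInvolution_eq_cosetAverage]
  exact continuous_cosetAverage η (continuous_liftedInvolution hφ)

theorem hasCompactSupport_cosetAverage [T2Space (G ⧸ H)] {f : G → ℂ} (hf : HasCompactSupport f) :
    HasCompactSupport (cosetAverage η f) := by
  refine HasCompactSupport.intro (hf.image (QuotientGroup.continuous_mk (N := H))) fun y hy => ?_
  obtain ⟨x, rfl⟩ := QuotientGroup.mk_surjective y
  rw [cosetAverage_mk]
  refine integral_eq_zero_of_ae (.of_forall fun h => ?_)
  refine image_eq_zero_of_notMem_tsupport fun hx => hy ⟨_, hx, ?_⟩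
  exact QuotientGroup.eq.2 (by simp)

theorem hasCompactSupport_fnInvolution [T2Space (G ⧸ H)] {φ : G ⧸ H → ℂ}
    (hφ : HasCompactSupport φ) : HasCompactSupport (fnInvolution η φ) := by
  rw [fnInvolution_eq_cosetAverage]
  exact hasCompactSupport_cosetAverage η (hasCompactSupport_liftedInvolution hφ)

end CosetAverage

end CosetMeasure

/-! ### Continuity of pairings on `L¹` and density of `C_c` -/

namespace MeasureTheory

variable {X : Type*} [MeasurableSpace X] {μ : Measure X}

theorem continuous_integral_mul_L1 {g : X → ℂ} (hg : AEStronglyMeasurable g μ) {C : ℝ}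
    (hC : ∀ x, ‖g x‖ ≤ C) : Continuous fun f : Lp ℂ 1 μ => ∫ x, g x * f x ∂μ := by
  refine LipschitzWith.continuous (K := C.toNNReal) (LipschitzWith.of_dist_le_mul fun f₁ f₂ => ?_)
  have h1 := (L1.integrable_coeFn f₁).bdd_mul hg (.of_forall hC)
  have h2 := (L1.integrable_coeFn f₂).bdd_mul hg (.of_forall hC)
  have h3 := ((L1.integrable_coeFn f₁).sub (L1.integrable_coeFn f₂)).norm
  have h4 : ∫ x, ‖(f₁ - f₂) x‖ ∂μ = ∫ x, ‖f₁ x - f₂ x‖ ∂μ :=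
    integral_congr_ae ((Lp.coeFn_sub f₁ f₂).fun_comp norm)
  rw [dist_eq_norm, ← integral_sub h1 h2, dist_eq_norm, L1.norm_eq_integral_norm,
    h4, ← integral_const_mul]
  refine norm_integral_le_of_norm_le (h3.const_mul _) (.of_forall fun x => ?_)
  rw [← mul_sub, norm_mul]
  exact mul_le_mul_of_nonneg_right ((hC x).trans (Real.le_coe_toNNReal C)) (norm_nonneg _)

theorem continuous_integral_mul_conj_L1 {g : X → ℂ} (hg : AEStronglyMeasurable g μ) {C : ℝ}
    (hC : ∀ x, ‖g x‖ ≤ C) :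
    Continuous fun f : Lp ℂ 1 μ => ∫ x, g x * starRingEnd ℂ (f x) ∂μ := by
  have h : ∀ f : Lp ℂ 1 μ, ∫ x, g x * starRingEnd ℂ (f x) ∂μ
      = starRingEnd ℂ (∫ x, starRingEnd ℂ (g x) * f x ∂μ) := by
    intro f
    rw [← integral_conj]
    simp
  simp_rw [h]
  exact Complex.continuous_conj.comp (continuous_integral_mul_L1
    (Complex.continuous_conj.comp_aestronglyMeasurable hg) (C := C) (by simpa using hC))

theorem dist_toL1_eq_integral_norm {f g : X → ℂ} (hf : Integrable f μ) (hg : Integrable g μ) :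
    dist (hf.toL1 f) (hg.toL1 g) = ∫ x, ‖f x - g x‖ ∂μ := by
  rw [dist_eq_norm, ← Integrable.toL1_sub, L1.norm_of_fun_eq_integral_norm]
  rfl

theorem dense_compactlySupported_L1 {X : Type*} [TopologicalSpace X] [MeasurableSpace X]
    [BorelSpace X] [R1Space X] [LocallyCompactSpace X] (μ : Measure X) [μ.Regular] :
    Dense {f : Lp ℂ 1 μ | ∃ ψ : C_c(X, ℂ), f =ᵐ[μ] ψ} := by
  refine EMetric.dense_iff.2 fun f ε hε => ?_
  have h2 : ε / 2 ≠ 0 := by simpa using hε.ne'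
  obtain ⟨ε', hε'0, hε'⟩ := exists_between hε
  obtain ⟨g, hgε, hgc, hgs⟩ :=
    (Lp.memLp f).exists_continuous_hasCompactSupport_eLpNorm_sub_le ENNReal.one_ne_top hε'0.ne'
  have hgm : MemLp g 1 μ := memLp_one_iff_integrable.2 (hgc.integrable_of_hasCompactSupport hgs)
  refine ⟨hgm.toLp g, ?_, ⟨⟨⟨g, hgc⟩, hgs⟩, hgm.coeFn_toLp⟩⟩
  rw [Metric.mem_eball, edist_comm, Lp.edist_def]
  refine lt_of_le_of_lt (le_trans (le_of_eq ?_) hgε) hε'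
  refine eLpNorm_congr_ae ?_
  filter_upwards [hgm.coeFn_toLp] with x hx
  simp [hx]

end MeasureTheory

/-! ### Adjointness, the `L¹` bound and the extension of the involution -/

namespace CosetMeasure

variable {G : Type*} [Group G] [TopologicalSpace G] [IsTopologicalGroup G]
  [LocallyCompactSpace G] [MeasurableSpace G] [BorelSpace G] {H : Subgroup G} [CompactSpace H]
  [MeasurableSpace (G ⧸ H)] [BorelSpace (G ⧸ H)]
  {σ : Measure G} {η : Measure H} [η.IsMulLeftInvariant] [IsProbabilityMeasure η]
  {μ : Measure (G ⧸ H)}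

theorem IsNormalizedInvariant.integral_cosetAverage (hμ : IsNormalizedInvariant σ η μ) {f : G → ℂ}
    (hf : Continuous f) (hfs : HasCompactSupport f) :
    ∫ y, cosetAverage η f y ∂μ = ∫ x, f x ∂σ :=
  hμ.weil ⟨⟨f, hf⟩, hfs⟩

/-- The involution of functions is adjoint to the averaged inversion. -/
theorem IsNormalizedInvariant.integral_mul_fnInvolution [σ.IsHaarMeasure]
    (hμ : IsNormalizedInvariant σ η μ) {ψ φ : G ⧸ H → ℂ} (hψ : Continuous ψ)
    (hφ : Continuous φ) (hφs : HasCompactSupport φ) :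
    ∫ y, ψ y * fnInvolution η φ y ∂μ = ∫ y, inverseAverage η ψ y * starRingEnd ℂ (φ y) ∂μ := by
  have hq : Continuous ((↑) : G → G ⧸ H) := QuotientGroup.continuous_mk
  have hconj := Complex.continuous_conj
  -- As a function on `G`, `ψ` is right `H`-invariant, so it can be moved inside the average.
  have h1 : ∀ y, ψ y * fnInvolution η φ y
      = cosetAverage η (fun x => ψ (x : G ⧸ H) * liftedInvolution φ x) y := by
    intro y
    obtain ⟨x, rfl⟩ := QuotientGroup.mk_surjective y
    rw [fnInvolution_eq_cosetAverage, cosetAverage_mk, cosetAverage_mk, ← integral_const_mul]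
    congr 1 with h
    rw [QuotientGroup.mk_mul_of_mem x h.2]
  have h2 : ∀ y, inverseAverage η ψ y * starRingEnd ℂ (φ y)
      = cosetAverage η (fun x => ψ ((x⁻¹ : G) : G ⧸ H) * starRingEnd ℂ (φ (x : G ⧸ H))) y := by
    intro y
    obtain ⟨x, rfl⟩ := QuotientGroup.mk_surjective y
    rw [inverseAverage, cosetAverage_mk, cosetAverage_mk, ← integral_mul_const]
    congr 1 with h
    rw [QuotientGroup.mk_mul_of_mem x h.2]
  have hs : HasCompactSupport fun x : G => starRingEnd ℂ (φ (x : G ⧸ H)) :=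
    (hasCompactSupport_comp_quotientMk hφs).comp_left (map_zero (starRingEnd ℂ))
  have hc : Continuous fun x : G =>
      ψ ((x⁻¹ : G) : G ⧸ H) * starRingEnd ℂ (φ (x : G ⧸ H)) := by fun_prop
  have hs' : HasCompactSupport fun x : G =>
      ψ ((x⁻¹ : G) : G ⧸ H) * starRingEnd ℂ (φ (x : G ⧸ H)) := hs.mul_left
  simp_rw [h1, h2]
  rw [hμ.integral_cosetAverage (f := fun x => ψ (x : G ⧸ H) * liftedInvolution φ x)
      ((hψ.comp hq).mul (continuous_liftedInvolution hφ))
      (hasCompactSupport_liftedInvolution hφs).mul_left,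
    hμ.integral_cosetAverage hc hs', ← integral_inv_mul_modularFn_inv σ hc hs']
  congr 1 with x
  rw [liftedInvolution, inv_inv]
  ring

theorem IsNormalizedInvariant.integral_fnInvolution [σ.IsHaarMeasure]
    (hμ : IsNormalizedInvariant σ η μ) {φ : G ⧸ H → ℂ} (hφ : Continuous φ)
    (hφs : HasCompactSupport φ) :
    ∫ y, fnInvolution η φ y ∂μ = ∫ y, starRingEnd ℂ (φ y) ∂μ := by
  have h := hμ.integral_mul_fnInvolution (continuous_const (y := (1 : ℂ))) hφ hφs
  have h1 : inverseAverage η (fun _ : G ⧸ H => (1 : ℂ)) = fun _ => 1 := by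
    ext y
    obtain ⟨x, rfl⟩ := QuotientGroup.mk_surjective y
    simp [inverseAverage_mk]
  simpa [h1] using h

theorem norm_fnInvolution_le (φ : G ⧸ H → ℂ) (y : G ⧸ H) :
    ‖fnInvolution η φ y‖ ≤ ‖fnInvolution η (fun z => (‖φ z‖ : ℂ)) y‖ := by
  obtain ⟨x, rfl⟩ := QuotientGroup.mk_surjective y
  rw [fnInvolution_mk, fnInvolution_mk, norm_mul, norm_mul]
  refine mul_le_mul_of_nonneg_left ?_ (norm_nonneg _)
  simp_rw [Complex.conj_ofReal, integral_complex_ofReal, Complex.norm_real]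
  rw [Real.norm_of_nonneg (integral_nonneg fun _ => norm_nonneg _)]
  simpa using norm_integral_le_integral_norm (μ := η)
    fun h : H => starRingEnd ℂ (φ (((h : G)⁻¹ * x⁻¹ : G) : G ⧸ H))

theorem fnInvolution_ofReal_norm (φ : G ⧸ H → ℂ) (y : G ⧸ H) :
    fnInvolution η (fun z => (‖φ z‖ : ℂ)) y = ‖fnInvolution η (fun z => (‖φ z‖ : ℂ)) y‖ := by
  obtain ⟨x, rfl⟩ := QuotientGroup.mk_surjective y
  simp_rw [fnInvolution_mk, Complex.conj_ofReal, integral_complex_ofReal, ← Complex.ofReal_mul,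
    Complex.norm_real]
  rw [Real.norm_of_nonneg (mul_nonneg (modularFn_pos _).le
    (integral_nonneg fun _ => norm_nonneg _))]

theorem fnInvolution_sub {φ ψ : G ⧸ H → ℂ} (hφ : Continuous φ) (hψ : Continuous ψ) (y : G ⧸ H) :
    fnInvolution η (fun z => φ z - ψ z) y = fnInvolution η φ y - fnInvolution η ψ y := by
  obtain ⟨x, rfl⟩ := QuotientGroup.mk_surjective y
  have hq : Continuous ((↑) : G → G ⧸ H) := QuotientGroup.continuous_mk
  have hconj := Complex.continuous_conj
  have hi : ∀ {φ : G ⧸ H → ℂ}, Continuous φ → Integrable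
      (fun h : H => starRingEnd ℂ (φ (((h : G)⁻¹ * x⁻¹ : G) : G ⧸ H))) η := fun hφ =>
    Continuous.integrable_of_hasCompactSupport (by fun_prop) (HasCompactSupport.of_compactSpace _)
  rw [fnInvolution_mk, fnInvolution_mk, fnInvolution_mk, ← mul_sub, ← integral_sub (hi hφ) (hi hψ)]
  simp_rw [map_sub]

variable [T2Space G]

theorem IsNormalizedInvariant.integrable_fnInvolution (hμ : IsNormalizedInvariant σ η μ)
    {φ : G ⧸ H → ℂ} (hφ : Continuous φ) (hφs : HasCompactSupport φ) :
    Integrable (fnInvolution η φ) μ := by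
  have := t2Space_quotient H
  have := hμ.regular
  exact (continuous_fnInvolution η hφ).integrable_of_hasCompactSupport
    (hasCompactSupport_fnInvolution η hφs)

variable [σ.IsHaarMeasure]

/-- The involution of compactly supported functions is norm decreasing for the `L¹`-norm. -/
theorem IsNormalizedInvariant.integral_norm_fnInvolution_le (hμ : IsNormalizedInvariant σ η μ)
    {φ : G ⧸ H → ℂ} (hφ : Continuous φ) (hφs : HasCompactSupport φ) :
    ∫ y, ‖fnInvolution η φ y‖ ∂μ ≤ ∫ y, ‖φ y‖ ∂μ := by
  have hc : Continuous fun z => (‖φ z‖ : ℂ) := by fun_prop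
  have hs : HasCompactSupport fun z => (‖φ z‖ : ℂ) :=
    hφs.comp_left (g := fun z : ℂ => (‖z‖ : ℂ)) (by simp)
  have h := hμ.integral_fnInvolution hc hs
  -- The involution of `|φ|` is real and nonnegative, so its integral is its `L¹` norm; it has the
  -- same integral as `|φ|` and dominates `|φ^*|`.
  rw [funext (fnInvolution_ofReal_norm (η := η) φ)] at h
  simp_rw [Complex.conj_ofReal, integral_complex_ofReal, Complex.ofReal_inj] at h
  rw [← h]
  exact integral_mono (hμ.integrable_fnInvolution hφ hφs).norm
    (hμ.integrable_fnInvolution hc hs).norm (norm_fnInvolution_le φ)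

theorem IsNormalizedInvariant.integral_norm_fnInvolution_sub_le
    (hμ : IsNormalizedInvariant σ η μ) (φ ψ : C_c(G ⧸ H, ℂ)) :
    ∫ y, ‖fnInvolution η φ y - fnInvolution η ψ y‖ ∂μ ≤ ∫ y, ‖φ y - ψ y‖ ∂μ := by
  have h : ∀ y, fnInvolution η φ y - fnInvolution η ψ y = fnInvolution η (fun z => φ z - ψ z) y :=
    fun y => (fnInvolution_sub (map_continuous φ) (map_continuous ψ) y).symm
  simp_rw [h]
  exact hμ.integral_norm_fnInvolution_le ((map_continuous φ).sub (map_continuous ψ))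
    (φ.hasCompactSupport.sub ψ.hasCompactSupport)

theorem IsNormalizedInvariant.exists_isInvolutionExtension (hμ : IsNormalizedInvariant σ η μ) :
    ∃ T, IsInvolutionExtension η μ T := by
  have := t2Space_quotient H
  have := hμ.regular
  let S : Set (Lp ℂ 1 μ) := {f | ∃ ψ : C_c(G ⧸ H, ℂ), f =ᵐ[μ] ψ}
  have hS : Dense S := dense_compactlySupported_L1 μ
  let rep : S → C_c(G ⧸ H, ℂ) := fun f => f.2.choose
  have hrep : ∀ f : S, (f : Lp ℂ 1 μ) =ᵐ[μ] rep f := fun f => f.2.choose_spec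
  have hint : ∀ ψ : C_c(G ⧸ H, ℂ), Integrable (fnInvolution η ψ) μ := fun ψ =>
    hμ.integrable_fnInvolution (map_continuous ψ) ψ.hasCompactSupport
  let T₀ : S → Lp ℂ 1 μ :=
    fun f => (hint (rep f)).toL1 _
  have hT₀ : LipschitzWith 1 T₀ := by
    refine LipschitzWith.of_dist_le_mul fun f g => ?_
    rw [NNReal.coe_one, one_mul, dist_toL1_eq_integral_norm]
    refine (hμ.integral_norm_fnInvolution_sub_le _ _).trans (le_of_eq ?_)
    rw [Subtype.dist_eq, dist_eq_norm, L1.norm_eq_integral_norm]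
    refine integral_congr_ae ?_
    filter_upwards [hrep f, hrep g, Lp.coeFn_sub (f : Lp ℂ 1 μ) g] with y h1 h2 h3
    rw [h3, Pi.sub_apply, h1, h2]
  refine ⟨hS.extend T₀, (hS.uniformContinuous_extend hT₀.uniformContinuous).continuous,
    fun ψ φ hφ => ?_⟩
  have h1 : hS.extend T₀ φ = T₀ ⟨φ, ψ, hφ⟩ := hS.extend_eq hT₀.continuous ⟨φ, ψ, hφ⟩
  rw [h1]
  -- The chosen representative need not be `ψ`; the contraction bound shows that almost everywhere
  -- equal representatives have almost everywhere equal involutions.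
  refine (hint _).coeFn_toL1.trans ?_
  have h2 := hμ.integral_norm_fnInvolution_sub_le (rep ⟨φ, ψ, hφ⟩) ψ
  have h3 : ∫ y, ‖rep ⟨φ, ψ, hφ⟩ y - ψ y‖ ∂μ = 0 := by
    refine integral_eq_zero_of_ae ?_
    filter_upwards [hrep ⟨φ, ψ, hφ⟩, hφ] with y h4 h5
    rw [← h4, h5]
    simp
  rw [h3] at h2
  have h6 := (integral_eq_zero_iff_of_nonneg (fun y => norm_nonneg _)
    ((hint (rep ⟨φ, ψ, hφ⟩)).sub (hint ψ)).norm).1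
    (le_antisymm h2 (integral_nonneg fun y => norm_nonneg _))
  filter_upwards [h6] with y hy
  exact sub_eq_zero.1 (norm_eq_zero.1 hy)

/-- A continuous extension of the involution to `L¹` is adjoint to the averaged inversion. -/
theorem IsNormalizedInvariant.integral_mul_involutionExtension (hμ : IsNormalizedInvariant σ η μ)
    {T : Lp ℂ 1 μ → Lp ℂ 1 μ} (hT : IsInvolutionExtension η μ T) {ψ : G ⧸ H → ℂ}
    (hψ : Continuous ψ) {C : ℝ} (hC : ∀ y, ‖ψ y‖ ≤ C) (φ : Lp ℂ 1 μ) :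
    ∫ y, ψ y * T φ y ∂μ = ∫ y, inverseAverage η ψ y * starRingEnd ℂ (φ y) ∂μ := by
  have := t2Space_quotient H
  have := hμ.regular
  refine congrFun (Continuous.ext_on (dense_compactlySupported_L1 μ)
    ((continuous_integral_mul_L1 hψ.aestronglyMeasurable hC).comp hT.1)
    (continuous_integral_mul_conj_L1 (continuous_inverseAverage η hψ).aestronglyMeasurable
      (norm_inverseAverage_le η hC)) ?_) φ
  rintro f ⟨g, hg⟩
  have h1 : ∫ y, ψ y * T f y ∂μ = ∫ y, ψ y * fnInvolution η g y ∂μ := by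
    refine integral_congr_ae ?_
    filter_upwards [hT.2 g f hg] with y hy
    rw [hy]
  have h2 : ∫ y, inverseAverage η ψ y * starRingEnd ℂ (f y) ∂μ
      = ∫ y, inverseAverage η ψ y * starRingEnd ℂ (g y) ∂μ := by
    refine integral_congr_ae ?_
    filter_upwards [hg] with y hy
    rw [hy]
  change ∫ y, ψ y * T f y ∂μ = ∫ y, inverseAverage η ψ y * starRingEnd ℂ (f y) ∂μ
  rw [h1, h2, hμ.integral_mul_fnInvolution hψ (map_continuous g) g.hasCompactSupport]

/-! ### Representing measures and the conclusion -/

theorem represents_densityMeasure [R1Space (G ⧸ H)] [μ.Regular] (φ : Lp ℂ 1 μ) :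
    Represents (densityMeasure μ φ) (fun ψ => ∫ y, ψ y * φ y ∂μ) :=
  ⟨regular_variation_withDensityᵥ (Lp.stronglyMeasurable φ) (L1.integrable_coeFn φ),
    fun ψ => integral_withDensityᵥ_complex (L1.integrable_coeFn φ)
      (map_continuous ψ).stronglyMeasurable (C := ‖ψ.toBCF‖) ψ.toBCF.norm_coe_le_norm⟩

theorem involutionFunctional_densityMeasure (φ : Lp ℂ 1 μ) (ψ : C₀(G ⧸ H, ℂ)) :
    involutionFunctional η (densityMeasure μ φ) ψ
      = ∫ y, inverseAverage η ψ y * starRingEnd ℂ (φ y) ∂μ := by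
  have hφ := L1.integrable_coeFn φ
  rw [involutionFunctional, densityMeasure, conjMeasure_withDensityᵥ hφ]
  exact integral_withDensityᵥ_complex
    ((LinearIsometryEquiv.integrable_comp_iff Complex.conjLIE).2 hφ)
    (continuous_inverseAverage η (map_continuous ψ)).stronglyMeasurable
    (norm_inverseAverage_le η (C := ‖ψ.toBCF‖) ψ.toBCF.norm_coe_le_norm)

/-- The regular complex measure representing a functional is unique. -/
theorem Represents.unique {X : Type*} [TopologicalSpace X] [MeasurableSpace X] [BorelSpace X]
    [R1Space X] [LocallyCompactSpace X] {ν₁ ν₂ : ComplexMeasure X} {Λ : C₀(X, ℂ) → ℂ}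
    (h₁ : Represents ν₁ Λ) (h₂ : Represents ν₂ Λ) : ν₁ = ν₂ := by
  refine ComplexMeasure.ext_of_integral_eq h₁.1 h₂.1 fun ψ hψ hψs => ?_
  let ψ₀ : C₀(X, ℂ) := ⟨⟨ψ, hψ⟩, hψs.is_zero_at_infty⟩
  exact (h₁.2 ψ₀).trans (h₂.2 ψ₀).symm

end CosetMeasure

theorem mainTheorem5 {G : Type*} [Group G] [TopologicalSpace G] [IsTopologicalGroup G]
    [LocallyCompactSpace G] [T2Space G] [MeasurableSpace G] [BorelSpace G]
    (H : Subgroup G) [CompactSpace H]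
    [MeasurableSpace (G ⧸ H)] [BorelSpace (G ⧸ H)]
    (σ : Measure G) [σ.IsHaarMeasure] [σ.Regular]
    (η : Measure H) [η.IsHaarMeasure] [η.Regular] [IsProbabilityMeasure η]
    (μ : Measure (G ⧸ H)) (hμ : CosetMeasure.IsNormalizedInvariant σ η μ) :
    CosetMeasure.IsInvolutionExtension η μ (CosetMeasure.l1Involution η μ) ∧
    ∀ φ : Lp ℂ 1 μ,
      CosetMeasure.Represents (CosetMeasure.densityMeasure μ φ)
        (fun ψ => ∫ y, ψ y * φ y ∂μ) ∧
      CosetMeasure.Represents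
        (CosetMeasure.measureInvolution η (CosetMeasure.densityMeasure μ φ))
        (CosetMeasure.involutionFunctional η (CosetMeasure.densityMeasure μ φ)) ∧
      CosetMeasure.measureInvolution η (CosetMeasure.densityMeasure μ φ)
        = CosetMeasure.densityMeasure μ (CosetMeasure.l1Involution η μ φ) := by
  have := CosetMeasure.t2Space_quotient H
  have := hμ.regular
  have hT : CosetMeasure.IsInvolutionExtension η μ (CosetMeasure.l1Involution η μ) := by
    have h := hμ.exists_isInvolutionExtension
    rw [CosetMeasure.l1Involution, dif_pos h]
    exact h.choose_spec
  refine ⟨hT, fun φ => ?_⟩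
  -- Adjointness makes the density measure of `φ^*` represent the functional that defines `(μ_φ)^*`,
  -- so the default value `0` in `rieszMeasure` is never used here.
  have hrep : CosetMeasure.Represents
      (CosetMeasure.densityMeasure μ (CosetMeasure.l1Involution η μ φ))
      (CosetMeasure.involutionFunctional η (CosetMeasure.densityMeasure μ φ)) := by
    have h := CosetMeasure.represents_densityMeasure (CosetMeasure.l1Involution η μ φ)
    refine ⟨h.1, fun ψ => (h.2 ψ).trans ?_⟩
    rw [CosetMeasure.involutionFunctional_densityMeasure]
    exact hμ.integral_mul_involutionExtension hT (map_continuous ψ) (C := ‖ψ.toBCF‖)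
      ψ.toBCF.norm_coe_le_norm φ
  have hinv : CosetMeasure.Represents
      (CosetMeasure.measureInvolution η (CosetMeasure.densityMeasure μ φ))
      (CosetMeasure.involutionFunctional η (CosetMeasure.densityMeasure μ φ)) := by
    have h : ∃ ν, CosetMeasure.Represents ν
        (CosetMeasure.involutionFunctional η (CosetMeasure.densityMeasure μ φ)) := ⟨_, hrep⟩
    rw [CosetMeasure.measureInvolution, CosetMeasure.rieszMeasure, dif_pos h]
    exact h.choose_spec
  exact ⟨CosetMeasure.represents_densityMeasure φ, hinv, hinv.unique hrep⟩
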